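/- Let $\alpha,\beta,\gamma$ be partitions and let $c_{\alpha\beta}^{\gamma}$ denote the Littlewood–Richardson coefficient, i.e. the number of Littlewood–Richardson tableaux of shape $\gamma/\alpha$ and content $\beta$: fillings of the boxes of $\gamma$ not in $\alpha$ with positive integers, weakly increasing along rows and strictly increasing down columns, in which each $k\ge 1$ occurs $\beta_k$ times, and such that, when the rows are read from right to left and from top to bottom, no initial part of the resulting word contains more letters $k+1$ than letters $k$, for any $k\ge 1$ (the number is $0$ if $\alpha\not\subseteq\gamma$). Here $\lambda\subseteq\mu$ means that $\lambda_i\le\mu_i$ for all $i$, i.e. that the Young diagram of $\lambda$ is contained in that of $\mu$. Suppose that $c_{\alpha\beta}^{\gamma}>0$, and let $\widetilde\gamma$ be a partition with $\widetilde\gamma\subseteq\gamma$. Then there are partitions $\widetilde\alpha\subseteq\alpha$ and $\widetilde\beta\subseteq\beta$ with $c_{\widetilde\alpha\widetilde\beta}^{\widetilde\gamma}>0$. -/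

import Mathlib

/-- The cells of the skew diagram `γ / α`: the boxes of `γ` that do not belong to `α`. -/
def skewCells (α γ : YoungDiagram) : Finset (ℕ × ℕ) :=
  γ.cells \ α.cells

/-- `T` is a Littlewood-Richardson tableau of shape `γ / α` and content `β`. Rows, columns and
letters are numbered from `0`, as for Mathlib's `SemistandardYoungTableau`; the letter `k` is the
letter `k + 1` of the usual convention. Outside the skew shape `T` is `0`, so that a tableau is
determined by its filling of the shape. -/
structure IsLRTableau (α β γ : YoungDiagram) (T : ℕ → ℕ → ℕ) : Prop where
  /-- The skew shape `γ / α` makes sense: `α` is contained in `γ`. -/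
  contained : α ≤ γ
  /-- The entries increase weakly from left to right in each row. -/
  row_weak : ∀ i j₁ j₂ : ℕ, j₁ < j₂ → (i, j₁) ∈ skewCells α γ → (i, j₂) ∈ skewCells α γ →
    T i j₁ ≤ T i j₂
  /-- The entries increase strictly from top to bottom in each column. -/
  col_strict : ∀ i₁ i₂ j : ℕ, i₁ < i₂ → (i₁, j) ∈ skewCells α γ → (i₂, j) ∈ skewCells α γ →
    T i₁ j < T i₂ j
  /-- `T` vanishes outside the skew shape. -/
  zeros : ∀ i j : ℕ, (i, j) ∉ skewCells α γ → T i j = 0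
  /-- The letter `k` occurs exactly as often as row `k` of `β` is long. -/
  content : ∀ k : ℕ, ((skewCells α γ).filter fun c => T c.1 c.2 = k).card = β.rowLen k
  /-- Lattice condition: read each row from right to left, the rows from top to bottom. In the
  part of this word up to position `(i, j)`, the letter `k + 1` never occurs more often than the
  letter `k`. -/
  lattice : ∀ i j k : ℕ,
    ((skewCells α γ).filter fun c =>
      (c.1 < i ∨ (c.1 = i ∧ j ≤ c.2)) ∧ T c.1 c.2 = k + 1).card ≤
    ((skewCells α γ).filter fun c =>
      (c.1 < i ∨ (c.1 = i ∧ j ≤ c.2)) ∧ T c.1 c.2 = k).card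

/-- The Littlewood-Richardson coefficient `c_{α β}^γ`: the number of Littlewood-Richardson
tableaux of shape `γ / α` and content `β` (in particular `0` if `α` is not contained in `γ`). -/
noncomputable def lrCoeff (α β γ : YoungDiagram) : ℕ :=
  {T : ℕ → ℕ → ℕ | IsLRTableau α β γ T}.ncard

/-- There are finitely many Littlewood-Richardson tableaux of given shape and content, so that
`lrCoeff` really counts them. -/
theorem finite_isLRTableau (α β γ : YoungDiagram) :
    {T : ℕ → ℕ → ℕ | IsLRTableau α β γ T}.Finite := by
  have hbound : ∀ T : ℕ → ℕ → ℕ, IsLRTableau α β γ T →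
      ∀ c ∈ skewCells α γ, T c.1 c.2 < β.colLen 0 := by
    intro T hT c hc
    have h1 : 0 < ((skewCells α γ).filter fun d => T d.1 d.2 = T c.1 c.2).card :=
      Finset.card_pos.mpr ⟨c, Finset.mem_filter.mpr ⟨hc, rfl⟩⟩
    rw [hT.content] at h1
    exact YoungDiagram.mem_iff_lt_colLen.mp (YoungDiagram.mem_iff_lt_rowLen.mpr h1)
  let f : {T : ℕ → ℕ → ℕ // IsLRTableau α β γ T} → (skewCells α γ → Fin (β.colLen 0)) :=
    fun T c => ⟨T.1 c.1.1 c.1.2, hbound T.1 T.2 c.1 c.2⟩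
  have hf : Function.Injective f := by
    intro S T h
    apply Subtype.ext
    funext i j
    by_cases hc : (i, j) ∈ skewCells α γ
    · exact congrArg Fin.val (congrFun h ⟨(i, j), hc⟩)
    · rw [S.2.zeros i j hc, T.2.zeros i j hc]
  exact Set.finite_coe_iff.mp (Finite.of_injective f hf)

/-! It suffices to remove one corner of `γ` at a time. A corner in `α` is removed from `α` as well.
Otherwise its letter `k` is lost. If the lattice condition between `k` and `k + 1` survives, row `k`
of `β` can be shortened. If not, in the first row where it fails the leftmost `k + 1` becomes a `k`
(`exists_succ`), so that now a `k + 1` is missing. This repeats with ever larger letters and stops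
because they are bounded by the number of rows of `β`. -/

theorem mem_skewCells {α γ : YoungDiagram} {c : ℕ × ℕ} :
    c ∈ skewCells α γ ↔ c ∈ γ ∧ c ∉ α := by
  simp [skewCells]

/-! ### Row-wise letter counts -/

/-- The number of cells of `D` in the rows above row `i` to which `T` assigns the letter `k`. -/
def letterCount (D : Finset (ℕ × ℕ)) (T : ℕ → ℕ → ℕ) (k i : ℕ) : ℕ :=
  (D.filter fun c => c.1 < i ∧ T c.1 c.2 = k).card

theorem letterCount_erase {D : Finset (ℕ × ℕ)} {c : ℕ × ℕ} (hc : c ∈ D) (T : ℕ → ℕ → ℕ)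
    (k i : ℕ) :
    letterCount D T k i =
      letterCount (D.erase c) T k i + if T c.1 c.2 = k ∧ c.1 < i then 1 else 0 := by
  unfold letterCount
  conv_lhs => rw [← Finset.insert_erase hc]
  rw [Finset.filter_insert]
  by_cases h : c.1 < i ∧ T c.1 c.2 = k
  · rw [if_pos h, if_pos h.symm, Finset.card_insert_of_notMem (by simp)]
  · rw [if_neg h, if_neg (fun h' => h h'.symm), add_zero]

theorem letterCount_congr {D : Finset (ℕ × ℕ)} {T T' : ℕ → ℕ → ℕ}
    (h : ∀ c ∈ D, T c.1 c.2 = T' c.1 c.2) (k i : ℕ) :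
    letterCount D T k i = letterCount D T' k i := by
  unfold letterCount
  congr 1
  apply Finset.filter_congr
  intro c hc
  rw [h c hc]

theorem letterCount_succ (D : Finset (ℕ × ℕ)) (T : ℕ → ℕ → ℕ) (k i : ℕ) :
    letterCount D T k (i + 1) =
      letterCount D T k i + (D.filter fun c => c.1 = i ∧ T c.1 c.2 = k).card := by
  unfold letterCount
  rw [← Finset.card_union_of_disjoint]
  · congr 1
    ext c
    simp only [Finset.mem_filter, Finset.mem_union]
    grind
  · rw [Finset.disjoint_left]
    simp only [Finset.mem_filter]
    grind

theorem letterCount_of_bound {D : Finset (ℕ × ℕ)} {M : ℕ} (hM : ∀ c ∈ D, c.1 < M)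
    (T : ℕ → ℕ → ℕ) (k : ℕ) :
    letterCount D T k M = (D.filter fun c => T c.1 c.2 = k).card := by
  unfold letterCount
  congr 1
  apply Finset.filter_congr
  intro c hc
  simp [hM c hc]

/-- The filling `T` with the entry in the cell `c` replaced by `v`. -/
def setEntry (T : ℕ → ℕ → ℕ) (c : ℕ × ℕ) (v : ℕ) : ℕ → ℕ → ℕ :=
  fun i j => if (i, j) = c then v else T i j

theorem letterCount_erase_setEntry (D : Finset (ℕ × ℕ)) (T : ℕ → ℕ → ℕ) (c : ℕ × ℕ)
    (v k i : ℕ) :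
    letterCount (D.erase c) (setEntry T c v) k i = letterCount (D.erase c) T k i := by
  apply letterCount_congr
  intro d hd
  simp [setEntry, Finset.ne_of_mem_erase hd]

theorem letterCount_setEntry {D : Finset (ℕ × ℕ)} {c : ℕ × ℕ} (hc : c ∈ D) (T : ℕ → ℕ → ℕ)
    (v k i : ℕ) :
    letterCount D (setEntry T c v) k i + (if T c.1 c.2 = k ∧ c.1 < i then 1 else 0) =
      letterCount D T k i + if v = k ∧ c.1 < i then 1 else 0 := by
  rw [letterCount_erase hc, letterCount_erase hc T, letterCount_erase_setEntry]
  simp only [setEntry, if_true]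
  omega

/-- Rows increase weakly, so right-to-left reading meets each `k + 1` of a row before any `k`. The
critical prefix stops between them, at the threshold column `j`. -/
theorem IsLRTableau.letterCount_le {α β γ : YoungDiagram} {T : ℕ → ℕ → ℕ}
    (hT : IsLRTableau α β γ T) (k i : ℕ) :
    letterCount (skewCells α γ) T (k + 1) (i + 1) ≤ letterCount (skewCells α γ) T k i := by
  obtain ⟨j, hj⟩ : ∃ j, ∀ j', (i, j') ∈ skewCells α γ → (j ≤ j' ↔ k + 1 ≤ T i j') := by
    classical
    have hex : ∃ j, ∀ j', j ≤ j' → (i, j') ∈ skewCells α γ → k + 1 ≤ T i j' := by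
      refine ⟨γ.rowLen i, fun j' hj' hm => ?_⟩
      have := YoungDiagram.mem_iff_lt_rowLen.mp
        (mem_skewCells.mp hm).1
      omega
    refine ⟨Nat.find hex, fun j' hm => ⟨fun h => Nat.find_spec hex j' h hm, fun h => ?_⟩⟩
    refine Nat.find_min' hex fun j'' hle hm'' => ?_
    rcases hle.eq_or_lt with rfl | hlt
    · exact h
    · exact h.trans (hT.row_weak i j' j'' hlt hm hm'')
  have hl := hT.lattice i j k
  unfold letterCount
  convert hl using 2 <;>
  · apply Finset.filter_congr
    rintro ⟨a, b⟩ hab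
    dsimp only
    by_cases ha : a = i
    · subst ha
      have := hj b hab
      omega
    · omega

/-! ### Fillings with one letter missing -/

/-- A filling of `γ / α` that is a Littlewood-Richardson tableau of content `β`, except that one
letter `k`, formerly in row `r`, is missing. -/
structure IsDefectiveLRTableau (α β γ : YoungDiagram) (k r : ℕ) (T : ℕ → ℕ → ℕ) : Prop where
  contained : α ≤ γ
  row_weak : ∀ i j₁ j₂ : ℕ, j₁ < j₂ → (i, j₁) ∈ skewCells α γ → (i, j₂) ∈ skewCells α γ →
    T i j₁ ≤ T i j₂
  col_strict : ∀ i₁ i₂ j : ℕ, i₁ < i₂ → (i₁, j) ∈ skewCells α γ → (i₂, j) ∈ skewCells α γ →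
    T i₁ j < T i₂ j
  zeros : ∀ i j : ℕ, (i, j) ∉ skewCells α γ → T i j = 0
  content : ∀ l : ℕ, ((skewCells α γ).filter fun c => T c.1 c.2 = l).card +
    (if l = k then 1 else 0) = β.rowLen l
  -- On the left the missing letter counts only for `r < i`, not `r < i + 1`: after a replacement in
  -- row `r`, the stronger bound fails at `i = r`.
  letterCount_le : ∀ l i : ℕ,
    letterCount (skewCells α γ) T (l + 1) (i + 1) + (if l + 1 = k ∧ r < i then 1 else 0) ≤
      letterCount (skewCells α γ) T l i + if l = k ∧ r < i then 1 else 0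

/-- The Young diagram `γ` with a maximal cell removed. -/
def eraseCorner (γ : YoungDiagram) (c : ℕ × ℕ) (hc : ∀ d ∈ γ, c ≤ d → d = c) : YoungDiagram where
  cells := γ.cells.erase c
  isLowerSet := by
    intro a b hba ha
    simp only [Finset.coe_erase, Set.mem_sdiff, Finset.mem_coe, YoungDiagram.mem_cells,
      Set.mem_singleton_iff] at ha ⊢
    refine ⟨γ.isLowerSet hba ha.1, ?_⟩
    rintro rfl
    exact ha.2 (hc a ha.1 hba)

theorem eraseCorner_le (γ : YoungDiagram) (c : ℕ × ℕ) (hc : ∀ d ∈ γ, c ≤ d → d = c) :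
    eraseCorner γ c hc ≤ γ :=
  Finset.erase_subset c γ.cells

theorem exists_rowLen_add_ite_eq {β : YoungDiagram} {k : ℕ}
    (hk : β.rowLen (k + 1) < β.rowLen k) :
    ∃ β' ≤ β, ∀ l, β'.rowLen l + (if l = k then 1 else 0) = β.rowLen l := by
  have hmax : ∀ d ∈ β, (k, β.rowLen k - 1) ≤ d → d = (k, β.rowLen k - 1) := by
    rintro ⟨a, b⟩ hd hle
    have h1 : k ≤ a := hle.1
    have h2 : β.rowLen k - 1 ≤ b := hle.2
    have h3 := YoungDiagram.mem_iff_lt_rowLen.mp hd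
    rcases h1.eq_or_lt with rfl | hlt
    · rw [Prod.mk.injEq]
      omega
    · have := β.rowLen_anti (k + 1) a hlt
      omega
  refine ⟨eraseCorner β _ hmax, eraseCorner_le _ _ _, fun l => ?_⟩
  have key : ∀ j, j < (eraseCorner β _ hmax).rowLen l ↔
      (l, j) ≠ (k, β.rowLen k - 1) ∧ j < β.rowLen l := by
    intro j
    rw [← YoungDiagram.mem_iff_lt_rowLen, ← YoungDiagram.mem_iff_lt_rowLen]
    exact Finset.mem_erase
  simp only [ne_eq, Prod.mk.injEq, not_and] at key
  split_ifs with h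
  · subst h
    have h1 := key (β.rowLen l - 1)
    have h2 := key ((eraseCorner β _ hmax).rowLen l)
    have h3 := key (β.rowLen l - 2)
    omega
  · have h1 := key (β.rowLen l)
    have h2 := key ((eraseCorner β _ hmax).rowLen l)
    simp only [h, false_imp_iff, true_and] at h1 h2
    omega

theorem fst_lt_of_mem_skewCells {α γ : YoungDiagram} {c : ℕ × ℕ} (hc : c ∈ skewCells α γ) :
    c.1 < γ.colLen 0 :=
  YoungDiagram.mem_iff_lt_colLen.mp
    (γ.up_left_mem le_rfl (Nat.zero_le c.2) (mem_skewCells.mp hc).1)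

namespace IsDefectiveLRTableau

variable {α β γ : YoungDiagram} {k r : ℕ} {T : ℕ → ℕ → ℕ}

/-- If the lattice condition holds between `k` and `k + 1`, then the missing letter may be dropped
from the content. -/
theorem exists_isLRTableau (hT : IsDefectiveLRTableau α β γ k r T)
    (hk : ∀ i, letterCount (skewCells α γ) T (k + 1) (i + 1) ≤
      letterCount (skewCells α γ) T k i) :
    ∃ β' ≤ β, IsLRTableau α β' γ T := by
  have hlat : ∀ l i, letterCount (skewCells α γ) T (l + 1) (i + 1) ≤
      letterCount (skewCells α γ) T l i := by
    intro l i
    by_cases h : l = k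
    · exact h ▸ hk i
    · have := hT.letterCount_le l i
      simp only [h, false_and, if_false] at this
      omega
  -- Over all rows, `T` has at most as many `k + 1` as `k`, and `β` counts one more `k`.
  have hrow : β.rowLen (k + 1) < β.rowLen k := by
    have h0 : ∀ c ∈ skewCells α γ, c.1 < γ.colLen 0 := fun c => fst_lt_of_mem_skewCells
    have h := hk (γ.colLen 0)
    rw [letterCount_of_bound h0,
      letterCount_of_bound fun c hc => (h0 c hc).trans (Nat.lt_succ_self _)] at h
    have h1 := hT.content k
    have h2 := hT.content (k + 1)
    simp only [if_true, if_neg (Nat.succ_ne_self k)] at h1 h2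
    omega
  obtain ⟨β', hβ', hlen⟩ := exists_rowLen_add_ite_eq hrow
  refine ⟨β', hβ', hT.contained, hT.row_weak, hT.col_strict, hT.zeros, fun l => ?_,
    fun i j l => ?_⟩
  · have h1 := hT.content l
    have h2 := hlen l
    omega
  · refine le_trans ?_ ((hlat l i).trans ?_) <;>
    · apply Finset.card_le_card
      apply Finset.monotone_filter_right
      intro c _ hc
      constructor
      · have := hc.1
        omega
      · exact hc.2

/-- At the first failure of the lattice condition between `k` and `k + 1`, the leftmost `k + 1` of
the row has no `k` above it. -/
theorem lt_of_leftmost (hT : IsDefectiveLRTableau α β γ k r T) {i j : ℕ}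
    (hcard : ((skewCells α γ).filter fun c => c.1 = i ∧ T c.1 c.2 = k).card <
      ((skewCells α γ).filter fun c => c.1 = i + 1 ∧ T c.1 c.2 = k + 1).card)
    (hmem : (i + 1, j) ∈ skewCells α γ) (hval : T (i + 1) j = k + 1)
    (hleft : ∀ j', (i + 1, j') ∈ skewCells α γ → T (i + 1) j' = k + 1 → j ≤ j')
    {i₁ : ℕ} (hi₁ : i₁ < i + 1) (hmem₁ : (i₁, j) ∈ skewCells α γ) : T i₁ j < k := by
  have hup : (i, j) ∈ skewCells α γ := by
    rw [mem_skewCells] at hmem hmem₁ ⊢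
    exact ⟨γ.up_left_mem (Nat.le_succ i) le_rfl hmem.1,
      fun h => hmem₁.2 (α.up_left_mem (Nat.le_of_lt_succ hi₁) le_rfl h)⟩
  have hlt := hT.col_strict _ _ _ (Nat.lt_succ_self i) hup hmem
  rw [Nat.succ_eq_add_one, hval] at hlt
  -- A `k` here would force a `k` above every `k + 1` of row `i + 1`, by weak rows and strict
  -- columns, contradicting `hcard`.
  have hne : T i j ≠ k := by
    intro hij
    refine absurd hcard (not_lt.mpr ?_)
    refine Finset.card_le_card_of_injOn (fun c => (i, c.2)) ?_ ?_
    · rintro ⟨a, b⟩ hc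
      simp only [Finset.coe_filter, Set.mem_ofPred_eq] at hc ⊢
      obtain ⟨hab, rfl, hv⟩ := hc
      have hjb := hleft b hab hv
      have hib : (i, b) ∈ skewCells α γ := by
        rw [mem_skewCells] at hab hup ⊢
        exact ⟨γ.up_left_mem (Nat.le_succ i) le_rfl hab.1,
          fun h => hup.2 (α.up_left_mem le_rfl hjb h)⟩
      have h1 := hT.col_strict _ _ _ (Nat.lt_succ_self i) hib hab
      have h2 : T i j ≤ T i b := by
        rcases hjb.eq_or_lt with rfl | h
        · exact le_rfl
        · exact hT.row_weak _ _ _ h hup hib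
      rw [Nat.succ_eq_add_one] at h1
      refine ⟨hib, trivial, ?_⟩
      omega
    · rintro ⟨a, b⟩ hc ⟨a', b'⟩ hc' h
      simp only [Finset.coe_filter, Set.mem_ofPred_eq, Prod.mk.injEq, true_and] at hc hc' h ⊢
      exact ⟨hc.2.1.trans hc'.2.1.symm, h⟩
  rcases (Nat.le_of_lt_succ hi₁).eq_or_lt with rfl | h
  · omega
  · have := hT.col_strict _ _ _ h hmem₁ hup
    omega

/-- If the lattice condition fails between `k` and `k + 1`, the missing `k` can be replaced by a
`k + 1` from a lower row. -/
theorem exists_succ (hT : IsDefectiveLRTableau α β γ k r T)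
    (hk : ∃ i, letterCount (skewCells α γ) T k i <
      letterCount (skewCells α γ) T (k + 1) (i + 1)) :
    ∃ r' T', IsDefectiveLRTableau α β γ (k + 1) r' T' := by
  classical
  obtain ⟨i, hi, hmin⟩ : ∃ i,
      letterCount (skewCells α γ) T k i < letterCount (skewCells α γ) T (k + 1) (i + 1) ∧
      ∀ m < i, letterCount (skewCells α γ) T (k + 1) (m + 1) ≤ letterCount (skewCells α γ) T k m :=
    ⟨Nat.find hk, Nat.find_spec hk, fun m hm => not_lt.mp (Nat.find_min hk hm)⟩
  have hle := hT.letterCount_le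
  -- Down to row `r` the missing letter does not enter the inequality, so failure occurs strictly
  -- below.
  have hri : r < i := by
    by_contra h
    have := hle k i
    simp only [h, and_false, if_false] at this
    omega
  obtain ⟨i, rfl⟩ : ∃ i', i = i' + 1 := ⟨i - 1, by omega⟩
  -- Subtract the inequality that still holds one row higher from the failing one.
  have hcard : ((skewCells α γ).filter fun c => c.1 = i ∧ T c.1 c.2 = k).card <
      ((skewCells α γ).filter fun c => c.1 = i + 1 ∧ T c.1 c.2 = k + 1).card := by
    have h1 := hmin i (Nat.lt_succ_self i)
    rw [letterCount_succ _ T (k + 1) (i + 1), letterCount_succ _ T k i] at hi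
    omega
  have hex : ∃ j, (i + 1, j) ∈ skewCells α γ ∧ T (i + 1) j = k + 1 := by
    obtain ⟨⟨a, b⟩, hc⟩ := Finset.card_pos.mp ((Nat.zero_le _).trans_lt hcard)
    simp only [Finset.mem_filter] at hc
    obtain ⟨h1, rfl, h2⟩ := hc
    exact ⟨b, h1, h2⟩
  obtain ⟨j, ⟨hmem, hval⟩, hleft⟩ : ∃ j, ((i + 1, j) ∈ skewCells α γ ∧ T (i + 1) j = k + 1) ∧
      ∀ j', (i + 1, j') ∈ skewCells α γ → T (i + 1) j' = k + 1 → j ≤ j' :=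
    ⟨Nat.find hex, Nat.find_spec hex, fun j' h h' => Nat.find_min' hex ⟨h, h'⟩⟩
  have hcount := fun l m => letterCount_setEntry hmem T k l m
  simp only [hval] at hcount
  refine ⟨i + 1, setEntry T (i + 1, j) k, hT.contained, ?_, ?_, ?_, ?_, ?_⟩
  · intro a j₁ j₂ hj h₁ h₂
    have h := hT.row_weak a j₁ j₂ hj h₁ h₂
    simp only [setEntry, Prod.mk.injEq]
    split_ifs with e₁ e₂ e₂
    · exact le_rfl
    · obtain ⟨rfl, rfl⟩ := e₁
      omega
    · obtain ⟨rfl, rfl⟩ := e₂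
      have hne : T (i + 1) j₁ ≠ k + 1 := fun h' => absurd (hleft j₁ h₁ h') (not_le.mpr hj)
      omega
    · exact h
  · intro i₁ i₂ b hb h₁ h₂
    have h := hT.col_strict i₁ i₂ b hb h₁ h₂
    simp only [setEntry, Prod.mk.injEq]
    split_ifs with e₁ e₂ e₂
    · omega
    · obtain ⟨rfl, rfl⟩ := e₁
      omega
    · obtain ⟨rfl, rfl⟩ := e₂
      exact hT.lt_of_leftmost hcard hmem hval hleft hb h₁
    · exact h
  · intro a b hab
    have hne : (a, b) ≠ (i + 1, j) := fun h => hab (h ▸ hmem)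
    simpa only [setEntry, if_neg hne] using hT.zeros a b hab
  · intro l
    have h1 := hT.content l
    have h2 := hcount l (γ.colLen 0)
    have h3 : i + 1 < γ.colLen 0 := fst_lt_of_mem_skewCells hmem
    simp only [h3, and_true] at h2
    rw [letterCount_of_bound fun c => fst_lt_of_mem_skewCells,
      letterCount_of_bound fun c => fst_lt_of_mem_skewCells] at h2
    simp only [eq_comm (a := k) (b := l), eq_comm (a := k + 1) (b := l)] at h2
    omega
  · intro l m
    have h1 := hcount l m
    have h2 := hcount (l + 1) (m + 1)
    have h3 := hle l m
    have h4 := hmin m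
    -- For `l = k`, minimality covers the rows above the replacement, and the old bound, slack by
    -- one, the others. For `l + 1 = k`, the added `k` is paid for by the missing one, as `r < i +
    -- 1`.
    by_cases hl : l = k
    · subst hl
      simp only [Nat.succ_ne_self, false_and, if_false, true_and, add_zero] at h1 h2 h3 ⊢
      clear hcount hle hmin
      split_ifs at * <;> omega
    · simp only [Ne.symm hl, hl, add_left_inj, false_and, if_false, add_zero] at h1 h2 h3 ⊢
      by_cases hl' : l + 1 = k
      · subst hl'
        simp only [true_and] at h1 h2 h3 ⊢
        clear hcount hle hmin
        split_ifs at * <;> omega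
      · simp only [Ne.symm hl', hl', false_and, if_false, add_zero,
          eq_comm (a := k + 1) (b := l)] at h1 h2 h3 ⊢
        omega

/-- Each replacement raises `k`, while a missing `k` requires row `k` of `β` to be nonempty. -/
theorem exists_isLRTableau_le (hT : IsDefectiveLRTableau α β γ k r T) :
    ∃ β' ≤ β, ∃ T', IsLRTableau α β' γ T' := by
  have hk : k < β.colLen 0 := by
    have h := hT.content k
    rw [if_pos rfl] at h
    exact YoungDiagram.mem_iff_lt_colLen.mp (YoungDiagram.mem_iff_lt_rowLen.mpr (by omega))
  induction hn : β.colLen 0 - k generalizing k r T with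
  | zero => omega
  | succ n ih =>
    by_cases h : ∀ i, letterCount (skewCells α γ) T (k + 1) (i + 1) ≤
        letterCount (skewCells α γ) T k i
    · obtain ⟨β', hβ', hT'⟩ := hT.exists_isLRTableau h
      exact ⟨β', hβ', T, hT'⟩
    · push Not at h
      obtain ⟨r', T', hT'⟩ := hT.exists_succ h
      refine ih hT' ?_ (by omega)
      have h := hT'.content (k + 1)
      rw [if_pos rfl] at h
      exact YoungDiagram.mem_iff_lt_colLen.mp (YoungDiagram.mem_iff_lt_rowLen.mpr (by omega))

end IsDefectiveLRTableau

/-! ### Removing corners of the outer shape -/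

theorem IsLRTableau.eraseCorner_of_notMem {α β γ : YoungDiagram} {T : ℕ → ℕ → ℕ}
    (hT : IsLRTableau α β γ T) {c : ℕ × ℕ} (hmax : ∀ d ∈ γ, c ≤ d → d = c) (hc : c ∈ γ)
    (hcα : c ∉ α) :
    IsDefectiveLRTableau α β (eraseCorner γ c hmax) (T c.1 c.2) c.1 (setEntry T c 0) := by
  have hcD : c ∈ skewCells α γ := mem_skewCells.mpr ⟨hc, hcα⟩
  have hD : skewCells α (eraseCorner γ c hmax) = (skewCells α γ).erase c :=
    Finset.erase_sdiff_comm _ _ _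
  have hmem : ∀ {d}, d ∈ (skewCells α γ).erase c → d ∈ skewCells α γ := Finset.mem_of_mem_erase
  have hval : ∀ {i j}, (i, j) ∈ (skewCells α γ).erase c → setEntry T c 0 i j = T i j :=
    fun h => if_neg (Finset.ne_of_mem_erase h)
  refine ⟨fun d hd => ?_, ?_, ?_, ?_, ?_, ?_⟩
  · exact Finset.mem_erase.mpr ⟨fun h => hcα (h ▸ hd), hT.contained hd⟩
  all_goals rw [hD]
  · intro i j₁ j₂ hj h₁ h₂
    rw [hval h₁, hval h₂]
    exact hT.row_weak i j₁ j₂ hj (hmem h₁) (hmem h₂)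
  · intro i₁ i₂ j hi h₁ h₂
    rw [hval h₁, hval h₂]
    exact hT.col_strict i₁ i₂ j hi (hmem h₁) (hmem h₂)
  · intro i j hij
    by_cases h : (i, j) = c
    · exact if_pos h
    · rw [setEntry, if_neg h]
      exact hT.zeros i j fun h' => hij (Finset.mem_erase.mpr ⟨h, h'⟩)
  · intro l
    have hb : ∀ d ∈ skewCells α γ, d.1 < γ.colLen 0 := fun d => fst_lt_of_mem_skewCells
    rw [← hT.content l, ← letterCount_of_bound hb,
      ← letterCount_of_bound fun d hd => hb d (hmem hd), letterCount_erase_setEntry,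
      letterCount_erase hcD]
    simp only [hb c hcD, and_true, eq_comm (a := l)]
  · intro l i
    have h := hT.letterCount_le l i
    rw [letterCount_erase hcD, letterCount_erase hcD T l] at h
    rw [letterCount_erase_setEntry, letterCount_erase_setEntry]
    split_ifs at * <;> omega

theorem IsLRTableau.eraseCorner_of_mem {α β γ : YoungDiagram} {T : ℕ → ℕ → ℕ}
    (hT : IsLRTableau α β γ T) {c : ℕ × ℕ} (hmax : ∀ d ∈ γ, c ≤ d → d = c) (hcα : c ∈ α) :
    IsLRTableau (eraseCorner α c fun d hd => hmax d (hT.contained hd)) β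
      (eraseCorner γ c hmax) T := by
  have hD : skewCells (eraseCorner α c fun d hd => hmax d (hT.contained hd))
      (eraseCorner γ c hmax) = skewCells α γ := by
    ext d
    simp only [skewCells, eraseCorner, Finset.mem_sdiff, Finset.mem_erase,
      YoungDiagram.mem_cells]
    by_cases h : d = c
    · simp [h, hcα]
    · simp [h]
  refine ⟨Finset.erase_subset_erase c hT.contained, ?_, ?_, ?_, ?_, ?_⟩
  all_goals rw [hD]
  exacts [hT.row_weak, hT.col_strict, hT.zeros, hT.content, hT.lattice]

/-- A corner of `γ` can be removed at the cost of at most one box of `α` or of `β`. -/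
theorem IsLRTableau.exists_eraseCorner {α β γ : YoungDiagram} {T : ℕ → ℕ → ℕ}
    (hT : IsLRTableau α β γ T) {c : ℕ × ℕ} (hmax : ∀ d ∈ γ, c ≤ d → d = c) (hc : c ∈ γ) :
    ∃ α' ≤ α, ∃ β' ≤ β, ∃ T', IsLRTableau α' β' (eraseCorner γ c hmax) T' := by
  by_cases hcα : c ∈ α
  · exact ⟨_, eraseCorner_le _ _ _, β, le_rfl, T, hT.eraseCorner_of_mem hmax hcα⟩
  · exact ⟨α, le_rfl, (hT.eraseCorner_of_notMem hmax hc hcα).exists_isLRTableau_le⟩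

/-- A maximal cell of the difference is maximal in `γ`, since `γ'` is a lower set. -/
theorem exists_corner_notMem {γ γ' : YoungDiagram} (h : γ' < γ) :
    ∃ c ∈ γ, c ∉ γ' ∧ ∀ d ∈ γ, c ≤ d → d = c := by
  have hne : (γ.cells \ γ'.cells).Nonempty :=
    Finset.sdiff_nonempty.mpr fun hle => h.not_ge hle
  obtain ⟨c, hc, hmax⟩ := Finset.exists_maximal hne
  rw [Finset.mem_sdiff] at hc
  refine ⟨c, hc.1, hc.2, fun d hd hcd => le_antisymm (hmax ?_ hcd) hcd⟩
  exact Finset.mem_sdiff.mpr ⟨hd, fun hd' => hc.2 (γ'.isLowerSet hcd hd')⟩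

theorem IsLRTableau.exists_of_le {α β γ γ' : YoungDiagram} {T : ℕ → ℕ → ℕ}
    (hT : IsLRTableau α β γ T) (hγ : γ' ≤ γ) :
    ∃ α' ≤ α, ∃ β' ≤ β, ∃ T', IsLRTableau α' β' γ' T' := by
  induction hn : γ.card using Nat.strong_induction_on generalizing α β γ T with
  | _ n ih =>
    rcases hγ.eq_or_lt with rfl | hlt
    · exact ⟨α, le_rfl, β, le_rfl, T, hT⟩
    · obtain ⟨c, hc, hc', hmax⟩ := exists_corner_notMem hlt
      obtain ⟨α₁, hα₁, β₁, hβ₁, T₁, hT₁⟩ := hT.exists_eraseCorner hmax hc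
      obtain ⟨α₂, hα₂, β₂, hβ₂, T₂, hT₂⟩ := ih _
        (hn ▸ Finset.card_erase_lt_of_mem ((YoungDiagram.mem_cells _).mpr hc)) hT₁
        (fun d hd => Finset.mem_erase.mpr ⟨fun h => hc' (h ▸ hd), hγ hd⟩) rfl
      exact ⟨α₂, hα₂.trans hα₁, β₂, hβ₂.trans hβ₁, T₂, hT₂⟩

theorem lrCoeff_pos_iff {α β γ : YoungDiagram} :
    0 < lrCoeff α β γ ↔ ∃ T, IsLRTableau α β γ T :=
  Set.ncard_pos (finite_isLRTableau α β γ)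

theorem lemma3 (α β γ γ' : YoungDiagram) (hc : 0 < lrCoeff α β γ) (hγ : γ' ≤ γ) :
    ∃ α' β' : YoungDiagram, α' ≤ α ∧ β' ≤ β ∧ 0 < lrCoeff α' β' γ' := by
  obtain ⟨T, hT⟩ := lrCoeff_pos_iff.mp hc
  obtain ⟨α', hα, β', hβ, hT'⟩ := hT.exists_of_le hγ
  exact ⟨α', β', hα, hβ, lrCoeff_pos_iff.mpr hT'⟩
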